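/- Let $(X,\sigma)$ be a closed connected symplectic manifold with universal cover $\pi\colon M\to X$, and suppose that $(X,\sigma)$ is symplectically hyperbolic, i.e. that there is a smooth 1-form $\lambda$ on $M$ with $d\lambda=\pi^*\sigma$ which is bounded with respect to the pullback to $M$ of a Riemannian metric on $X$. Fix such a bounded primitive $\lambda$ and a base point $x\in M$. View the group $\mathrm{Ham}(X,\sigma)$ of Hamiltonian diffeomorphisms (time-one maps of Hamiltonian isotopies) as a group of diffeomorphisms of $M$, namely the group of all time-one maps $\tilde f_1$, where $(\tilde f_t)$ is the lift with $\tilde f_0=\mathrm{id}_M$ of a Hamiltonian isotopy $(f_t)_{t\in[0,1]}$ of $(X,\sigma)$ with $f_0=\mathrm{id}_X$; every $f\in\mathrm{Ham}(X,\sigma)$ has such a lift. For $g,h$ in this group put $$\mathfrak G(g,h)=\int_x^{h(x)} g^*\lambda-\lambda .$$ Then the integral does not depend on the choice of the path from $x$ to $h(x)$ (and such paths exist), and $\mathfrak G$ is a semibounded two-cocycle on $\mathrm{Ham}(X,\sigma)$: it satisfies $\mathfrak G(g,h)-\mathfrak G(fg,h)+\mathfrak G(f,gh)-\mathfrak G(f,g)=0$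 for all $f,g,h$, and for every $g$ $$\sup_{h}|\mathfrak G(g,h)|<\infty .$$ -/

import Mathlib

open scoped Manifold ContDiff Topology

noncomputable section

namespace SympHyp

section Forms

variable {E : Type*} [NormedAddCommGroup E] [NormedSpace ℝ E]
variable {M : Type*} [TopologicalSpace M] [ChartedSpace E M]
variable {N : Type*} [TopologicalSpace N] [ChartedSpace E N]

/-- A (not necessarily continuous) differential `k`-form on a manifold `M` modelled on `E`:
an alternating `k`-linear form on every tangent space. -/
abbrev DForm (E : Type*) [NormedAddCommGroup E] [NormedSpace ℝ E]
    (M : Type*) [TopologicalSpace M] [ChartedSpace E M] (k : ℕ) : Type _ :=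
  (m : M) → (TangentSpace 𝓘(ℝ, E) m) [⋀^Fin k]→L[ℝ] ℝ

/-- The pullback `f^* α` of a form. -/
def pullback {k : ℕ} (f : M → N) (α : DForm E N k) : DForm E M k :=
  fun m => (α (f m)).compContinuousLinearMap (mfderiv 𝓘(ℝ, E) 𝓘(ℝ, E) f m)

/-- The expression of the form `α` in the preferred chart at `m₀`: the pullback of `α` under the
inverse of the chart. It is meaningful on the target of that chart, an open subset of `E`. -/
def chartRep {k : ℕ} (α : DForm E M k) (m₀ : M) : E → E [⋀^Fin k]→L[ℝ] ℝ :=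
  fun y => (α ((extChartAt 𝓘(ℝ, E) m₀).symm y)).compContinuousLinearMap
    (mfderiv 𝓘(ℝ, E) 𝓘(ℝ, E) (extChartAt 𝓘(ℝ, E) m₀).symm y)

/-- A form is smooth if all its chart expressions are smooth. -/
def IsSmoothForm {k : ℕ} (α : DForm E M k) : Prop :=
  ∀ m₀ : M, ContDiffOn ℝ ∞ (chartRep α m₀) (extChartAt 𝓘(ℝ, E) m₀).target

/-- `η = dα`, tested in charts with the exterior derivative of forms on `E`. -/
def IsExteriorDerivative {k : ℕ} (α : DForm E M k) (η : DForm E M (k + 1)) : Prop :=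
  ∀ m₀ : M, ∀ y ∈ (extChartAt 𝓘(ℝ, E) m₀).target,
    extDeriv (chartRep α m₀) y = chartRep η m₀ y

/-- A symplectic form: a smooth, closed and nondegenerate 2-form. -/
structure IsSymplectic (σ : DForm E M 2) : Prop where
  smooth : IsSmoothForm σ
  closed : IsExteriorDerivative σ 0
  nondegenerate : ∀ (m : M) (u : TangentSpace 𝓘(ℝ, E) m),
    (∀ v : TangentSpace 𝓘(ℝ, E) m, σ m ![u, v] = 0) → u = 0

/-- `γ`, restricted to `[0,1]`, is a `C¹` path from `x` to `y`. -/
def IsPathFromTo (γ : ℝ → M) (x y : M) : Prop :=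
  ContMDiffOn 𝓘(ℝ, ℝ) 𝓘(ℝ, E) 1 γ (Set.Icc 0 1) ∧ γ 0 = x ∧ γ 1 = y

/-- The integral `∫_γ α` of a 1-form along the path `γ : [0,1] → M`. -/
def pathIntegral (α : DForm E M 1) (γ : ℝ → M) : ℝ :=
  ∫ t in (0 : ℝ)..1,
    α (γ t) (fun _ => mfderivWithin 𝓘(ℝ, ℝ) 𝓘(ℝ, E) γ (Set.Icc 0 1) t (1 : ℝ))

end Forms

section Diffeo

variable {E : Type*} [NormedAddCommGroup E] [NormedSpace ℝ E]
variable {M : Type*} [TopologicalSpace M] [ChartedSpace E M]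

/-- The group of (smooth) diffeomorphisms of `M`, under composition: `(g * h) m = g (h m)`. -/
abbrev Diff (E : Type*) [NormedAddCommGroup E] [NormedSpace ℝ E]
    (M : Type*) [TopologicalSpace M] [ChartedSpace E M] : Type _ :=
  Diffeomorph 𝓘(ℝ, E) 𝓘(ℝ, E) M M ∞

instance : Group (Diff E M) where
  mul g h := Diffeomorph.trans h g
  one := Diffeomorph.refl 𝓘(ℝ, E) M ∞
  inv g := Diffeomorph.symm g
  mul_assoc _ _ _ := rfl
  one_mul _ := rfl
  mul_one _ := rfl
  inv_mul_cancel g := Diffeomorph.self_trans_symm g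

theorem Diff.mul_apply (g h : Diff E M) (m : M) : (g * h) m = g (h m) := rfl

theorem Diff.one_apply (m : M) : (1 : Diff E M) m = m := rfl

theorem Diff.apply_inv (g : Diff E M) (m : M) : g (g⁻¹ m) = m := Diffeomorph.apply_symm_apply g m

/-- `𝔊_{x,lam}(g,h) = ∫_x^{h(x)} (g^* lam - lam)`, the integral being taken along some `C¹` path
from `x` to `h(x)` (by convention it is `0` if there is none). -/
def cocycleG (x : M) (lam : DForm E M 1) (g h : Diff E M) : ℝ :=
  open Classical in
  if hp : ∃ γ : ℝ → M, IsPathFromTo (E := E) γ x (h x) then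
    pathIntegral (pullback g lam - lam) hp.choose
  else 0

end Diffeo

section Cochains

variable {G : Type*} [Group G]

/-- Inhomogeneous group two-cocycles with values in the trivial module `ℝ`. -/
def IsTwoCocycle (c : G → G → ℝ) : Prop :=
  ∀ f g h : G, c g h - c (f * g) h + c f (g * h) - c f g = 0

/-- `c` is semibounded if for every `g` the function `h ↦ c(g,h)` is bounded:
`sup_h |c(g,h)| < ∞`. -/
def IsSemibounded (c : G → G → ℝ) : Prop :=
  ∀ g : G, BddAbove (Set.range fun h : G => |c g h|)

end Cochains

section Ham

variable {E : Type*} [NormedAddCommGroup E] [NormedSpace ℝ E]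
variable {X : Type*} [TopologicalSpace X] [ChartedSpace E X]
variable {M : Type*} [TopologicalSpace M] [ChartedSpace E M]

/-- `π : M → X` is the smooth universal cover of `X`. -/
structure IsUniversalCover (π : M → X) : Prop where
  simplyConnected : SimplyConnectedSpace M
  covering : IsCoveringMap π
  localDiffeo : IsLocalDiffeomorph 𝓘(ℝ, E) 𝓘(ℝ, E) ∞ π

/-- `lam` is a smooth primitive of `π^* σ` on `M` which is bounded with respect to the pullback
`π^* ρ` of some Riemannian metric `ρ` on `X`. -/
structure IsBoundedPrimitive [IsManifold 𝓘(ℝ, E) ∞ X] (π : M → X) (σ : DForm E X 2)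
    (lam : DForm E M 1) : Prop where
  smooth : IsSmoothForm lam
  primitive : IsExteriorDerivative lam (pullback π σ)
  bounded : ∃ ρ : Bundle.ContMDiffRiemannianMetric 𝓘(ℝ, E) ∞ E
      (fun p : X => TangentSpace 𝓘(ℝ, E) p), ∃ C : ℝ,
    ∀ (m : M) (v : TangentSpace 𝓘(ℝ, E) m),
      |lam m (fun _ => v)| ≤
        C * √(ρ.inner (π m) (mfderiv 𝓘(ℝ, E) 𝓘(ℝ, E) π m v) (mfderiv 𝓘(ℝ, E) 𝓘(ℝ, E) π m v))

/-- The tangent vector `u` at `p` is the value at `p` of the Hamiltonian vector field of `K`: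
`σ(u, ·) = dK`. -/
def IsHamiltonianVector (σ : DForm E X 2) (K : X → ℝ) (p : X)
    (u : TangentSpace 𝓘(ℝ, E) p) : Prop :=
  ∀ v : TangentSpace 𝓘(ℝ, E) p, σ p ![u, v] = mfderiv 𝓘(ℝ, E) 𝓘(ℝ, ℝ) K p v

/-- `φ` is the Hamiltonian isotopy generated by the smooth time-dependent Hamiltonian `H`: it
starts at the identity and `∂_t φ_t = X_t ∘ φ_t` with `σ(X_t, ·) = dH_t`. Only the times
`t ∈ [0,1]` matter; the parameter is allowed to be any real number, which gives the same time-one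
maps. -/
structure IsHamiltonianIsotopy (σ : DForm E X 2) (H : ℝ → X → ℝ) (φ : ℝ → Diff E X) : Prop where
  smooth_ham : ContMDiff (𝓘(ℝ, ℝ).prod 𝓘(ℝ, E)) 𝓘(ℝ, ℝ) ∞ (fun q : ℝ × X => H q.1 q.2)
  smooth : ContMDiff (𝓘(ℝ, ℝ).prod 𝓘(ℝ, E)) 𝓘(ℝ, E) ∞ (fun q : ℝ × X => φ q.1 q.2)
  zero : φ 0 = 1
  hamilton : ∀ (t : ℝ) (p : X), IsHamiltonianVector σ (H t) (φ t p)
    (mfderiv 𝓘(ℝ, ℝ) 𝓘(ℝ, E) (fun s : ℝ => φ s p) t (1 : ℝ))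

/-- `ψ` is the lift to `M` of the isotopy `φ` of `X` that starts at the identity of `M`. -/
structure IsLiftedIsotopy (π : M → X) (φ : ℝ → Diff E X) (ψ : ℝ → Diff E M) : Prop where
  smooth : ContMDiff (𝓘(ℝ, ℝ).prod 𝓘(ℝ, E)) 𝓘(ℝ, E) ∞ (fun q : ℝ × M => ψ q.1 q.2)
  zero : ψ 0 = 1
  lift : ∀ (t : ℝ) (m : M), π (ψ t m) = φ t (π m)

end Ham

section Group

variable {E : Type*} [NormedAddCommGroup E] [NormedSpace ℝ E]
variable {X : Type*} [TopologicalSpace X] [ChartedSpace E X]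
variable {M : Type*} [TopologicalSpace M] [ChartedSpace E M]

theorem alternating_two_smul {V : Type*} [AddCommGroup V] [Module ℝ V] [TopologicalSpace V]
    (α : V [⋀^Fin 2]→L[ℝ] ℝ) (c : ℝ) (u v : V) : α ![c • u, v] = c * α ![u, v] := by
  have h3 := α.toAlternatingMap.map_update_smul (![u, v]) 0 c u
  have h4 : ∀ w : V, Function.update (![u, v]) 0 w = ![w, v] := by
    intro w
    ext i
    fin_cases i <;> rfl
  rw [h4, h4] at h3
  exact h3

theorem IsHamiltonianVector.smul {σ : DForm E X 2} {K K' : X → ℝ}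
    {p p' : X} {u u' : E} (c : ℝ) (hp : p = p') (hu : u = c • u') (hK : K = fun z => c * K' z)
    (hd : MDifferentiableAt 𝓘(ℝ, E) 𝓘(ℝ, ℝ) K' p')
    (h : IsHamiltonianVector σ K' p' u') : IsHamiltonianVector σ K p u := by
  subst hp hu hK
  intro v
  have h1 : σ p ![(c • u' : E), v] = c * σ p ![u', v] := alternating_two_smul (σ p) c u' v
  have h2 : mfderiv 𝓘(ℝ, E) 𝓘(ℝ, ℝ) (fun z => c * K' z) p = c • mfderiv 𝓘(ℝ, E) 𝓘(ℝ, ℝ) K' p :=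
    const_smul_mfderiv hd c
  refine h1.trans ?_
  rw [h v, h2]
  rfl

theorem IsHamiltonianIsotopy.reparam {σ : DForm E X 2} {H : ℝ → X → ℝ} {φ : ℝ → Diff E X}
    (h : IsHamiltonianIsotopy σ H φ) {b : ℝ → ℝ} {b' t : ℝ} (hb : HasDerivAt b b' t) (p : X)
    {γ : ℝ → X} (hγ : γ =ᶠ[𝓝 t] fun s => φ (b s) p) {K : X → ℝ}
    (hK : K = fun z => b' * H (b t) z) :
    IsHamiltonianVector σ K (γ t) (mfderiv 𝓘(ℝ, ℝ) 𝓘(ℝ, E) γ t (1 : ℝ)) := by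
  have hφ : MDifferentiableAt 𝓘(ℝ, ℝ) 𝓘(ℝ, E) (fun s : ℝ => φ s p) (b t) :=
    (h.smooth.comp (contMDiff_id.prodMk contMDiff_const)).mdifferentiableAt (by simp)
  have hH : MDifferentiableAt 𝓘(ℝ, E) 𝓘(ℝ, ℝ) (H (b t)) (φ (b t) p) :=
    (h.smooth_ham.comp (contMDiff_const.prodMk contMDiff_id)).mdifferentiableAt (by simp)
  refine IsHamiltonianVector.smul b' hγ.eq_of_nhds ?_ hK hH (h.hamilton (b t) p)
  have e1 : (mfderiv 𝓘(ℝ, ℝ) 𝓘(ℝ, E) γ t : ℝ →L[ℝ] E) =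
      mfderiv 𝓘(ℝ, ℝ) 𝓘(ℝ, E) (fun s => φ (b s) p) t := hγ.mfderiv_eq
  have e2 : (mfderiv 𝓘(ℝ, ℝ) 𝓘(ℝ, E) (fun s => φ (b s) p) t : ℝ →L[ℝ] E) =
      (mfderiv 𝓘(ℝ, ℝ) 𝓘(ℝ, E) (fun s => φ s p) (b t) : ℝ →L[ℝ] E).comp
        (ContinuousLinearMap.toSpanSingleton ℝ b') :=
    (hφ.hasMFDerivAt.comp t hb.hasFDerivAt.hasMFDerivAt).mfderiv
  have e3 : ∀ L : ℝ →L[ℝ] E, L.comp (ContinuousLinearMap.toSpanSingleton ℝ b') 1 = b' • L 1 := by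
    intro L
    rw [← map_smul]
    simp
  exact (congrArg (fun L : ℝ →L[ℝ] E => L 1) (e1.trans e2)).trans (e3 _)

theorem IsHamiltonianIsotopy.one (σ : DForm E X 2) :
    IsHamiltonianIsotopy σ (fun _ _ => 0) (fun _ => 1) where
  smooth_ham := contMDiff_const
  smooth := contMDiff_snd
  zero := rfl
  hamilton t p := by
    intro v
    have h1 : mfderiv 𝓘(ℝ, ℝ) 𝓘(ℝ, E) (fun _ : ℝ => (1 : Diff E X) p) t = 0 := mfderiv_const
    have h2 : mfderiv 𝓘(ℝ, E) 𝓘(ℝ, ℝ) (fun _ : X => (0 : ℝ)) p = 0 := mfderiv_const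
    rw [h1]
    refine Eq.trans ?_ (congrArg (fun L => L v) h2).symm
    exact (σ p).map_coord_zero 0 rfl

/-- A smooth monotone function which is `0` for `t ≤ 0` and `1` for `t ≥ 1/3`. -/
def cut₁ (t : ℝ) : ℝ := Real.smoothTransition (3 * t)

/-- A smooth monotone function which is `0` for `t ≤ 2/3` and `1` for `t ≥ 1`. -/
def cut₂ (t : ℝ) : ℝ := Real.smoothTransition (3 * t - 2)

theorem contDiff_cut₁ : ContDiff ℝ ∞ cut₁ :=
  Real.smoothTransition.contDiff.comp (contDiff_const.mul contDiff_id)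

theorem contDiff_cut₂ : ContDiff ℝ ∞ cut₂ :=
  Real.smoothTransition.contDiff.comp ((contDiff_const.mul contDiff_id).sub contDiff_const)

theorem cut₁_eq_one {t : ℝ} (ht : 1 / 3 < t) : cut₁ t = 1 :=
  Real.smoothTransition.one_of_one_le (by linarith)

theorem cut₂_eq_zero {t : ℝ} (ht : t < 2 / 3) : cut₂ t = 0 :=
  Real.smoothTransition.zero_of_nonpos (by linarith)

/-- Concatenation: first run `φ'`, then `φ`. -/
def concat (φ φ' : ℝ → Diff E X) : ℝ → Diff E X := fun t => φ (cut₂ t) * φ' (cut₁ t)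

theorem contMDiff_concat {φ φ' : ℝ → Diff E X}
    (h : ContMDiff (𝓘(ℝ, ℝ).prod 𝓘(ℝ, E)) 𝓘(ℝ, E) ∞ (fun q : ℝ × X => φ q.1 q.2))
    (h' : ContMDiff (𝓘(ℝ, ℝ).prod 𝓘(ℝ, E)) 𝓘(ℝ, E) ∞ (fun q : ℝ × X => φ' q.1 q.2)) :
    ContMDiff (𝓘(ℝ, ℝ).prod 𝓘(ℝ, E)) 𝓘(ℝ, E) ∞ (fun q : ℝ × X => concat φ φ' q.1 q.2) := by
  have h1 : ContMDiff (𝓘(ℝ, ℝ).prod 𝓘(ℝ, E)) 𝓘(ℝ, ℝ) ∞ (fun q : ℝ × X => cut₁ q.1) :=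
    contDiff_cut₁.contMDiff.comp contMDiff_fst
  have h2 : ContMDiff (𝓘(ℝ, ℝ).prod 𝓘(ℝ, E)) 𝓘(ℝ, ℝ) ∞ (fun q : ℝ × X => cut₂ q.1) :=
    contDiff_cut₂.contMDiff.comp contMDiff_fst
  exact h.comp (h2.prodMk (h'.comp (h1.prodMk contMDiff_snd)))

theorem concat_zero {φ φ' : ℝ → Diff E X} (h : φ 0 = 1) (h' : φ' 0 = 1) :
    concat φ φ' 0 = 1 := by
  simp [concat, cut₁, cut₂, h, h', Real.smoothTransition.zero_of_nonpos]

theorem concat_one (φ φ' : ℝ → Diff E X) : concat φ φ' 1 = φ 1 * φ' 1 := by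
  have h1 : cut₁ 1 = 1 := cut₁_eq_one (by norm_num)
  have h2 : cut₂ 1 = 1 := Real.smoothTransition.one_of_one_le (by norm_num)
  simp [concat, h1, h2]

theorem IsHamiltonianIsotopy.concat {σ : DForm E X 2} {H H' : ℝ → X → ℝ} {φ φ' : ℝ → Diff E X}
    (h : IsHamiltonianIsotopy σ H φ) (h' : IsHamiltonianIsotopy σ H' φ') :
    IsHamiltonianIsotopy σ
      (fun t z => deriv cut₁ t * H' (cut₁ t) z + deriv cut₂ t * H (cut₂ t) z)
      (concat φ φ') where
  smooth_ham := by
    have d1 : ContDiff ℝ ∞ (deriv cut₁) := (contDiff_infty_iff_deriv.1 contDiff_cut₁).2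
    have d2 : ContDiff ℝ ∞ (deriv cut₂) := (contDiff_infty_iff_deriv.1 contDiff_cut₂).2
    have h1 : ContMDiff (𝓘(ℝ, ℝ).prod 𝓘(ℝ, E)) 𝓘(ℝ, ℝ) ∞ (fun q : ℝ × X => cut₁ q.1) :=
      contDiff_cut₁.contMDiff.comp contMDiff_fst
    have h2 : ContMDiff (𝓘(ℝ, ℝ).prod 𝓘(ℝ, E)) 𝓘(ℝ, ℝ) ∞ (fun q : ℝ × X => cut₂ q.1) :=
      contDiff_cut₂.contMDiff.comp contMDiff_fst
    exact ((d1.contMDiff.comp contMDiff_fst).mul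
        (h'.smooth_ham.comp (h1.prodMk contMDiff_snd))).add
      ((d2.contMDiff.comp contMDiff_fst).mul (h.smooth_ham.comp (h2.prodMk contMDiff_snd)))
  smooth := contMDiff_concat h.smooth h'.smooth
  zero := concat_zero h.zero h'.zero
  hamilton t p := by
    have d1 : HasDerivAt cut₁ (deriv cut₁ t) t :=
      (contDiff_cut₁.differentiable (by simp) t).hasDerivAt
    have d2 : HasDerivAt cut₂ (deriv cut₂ t) t :=
      (contDiff_cut₂.differentiable (by simp) t).hasDerivAt
    rcases lt_or_ge t (2 / 3) with ht | ht
    · have hz : deriv cut₂ t = 0 := by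
        have : cut₂ =ᶠ[𝓝 t] fun _ => 0 := by
          filter_upwards [Iio_mem_nhds ht] with s hs using cut₂_eq_zero hs
        rw [this.deriv_eq, deriv_const]
      refine h'.reparam d1 p (γ := fun s => SympHyp.concat φ φ' s p) ?_ ?_
      · filter_upwards [Iio_mem_nhds ht] with s hs
        simp [SympHyp.concat, cut₂_eq_zero hs, h.zero]
      · simp [hz]
    · have ht' : 1 / 3 < t := by linarith
      have hz : deriv cut₁ t = 0 := by
        have : cut₁ =ᶠ[𝓝 t] fun _ => 1 := by
          filter_upwards [Ioi_mem_nhds ht'] with s hs using cut₁_eq_one hs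
        rw [this.deriv_eq, deriv_const]
      refine h.reparam d2 (φ' 1 p) (γ := fun s => SympHyp.concat φ φ' s p) ?_ ?_
      · filter_upwards [Ioi_mem_nhds ht'] with s hs
        simp [SympHyp.concat, cut₁_eq_one hs, Diff.mul_apply]
      · simp [hz]

theorem IsHamiltonianIsotopy.inv {σ : DForm E X 2} {H : ℝ → X → ℝ} {φ : ℝ → Diff E X}
    (h : IsHamiltonianIsotopy σ H φ) :
    IsHamiltonianIsotopy σ (fun t z => -1 * H (1 - t) z) (fun t => φ (1 - t) * (φ 1)⁻¹) where
  smooth_ham := by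
    have h1 : ContMDiff (𝓘(ℝ, ℝ).prod 𝓘(ℝ, E)) 𝓘(ℝ, ℝ) ∞ (fun q : ℝ × X => 1 - q.1) :=
      contMDiff_const.sub contMDiff_fst
    exact contMDiff_const.mul (h.smooth_ham.comp (h1.prodMk contMDiff_snd))
  smooth := by
    have h1 : ContMDiff (𝓘(ℝ, ℝ).prod 𝓘(ℝ, E)) 𝓘(ℝ, ℝ) ∞ (fun q : ℝ × X => 1 - q.1) :=
      contMDiff_const.sub contMDiff_fst
    exact h.smooth.comp (h1.prodMk (((φ 1)⁻¹ : Diff E X).contMDiff.comp contMDiff_snd))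
  zero := by simp
  hamilton t p :=
    h.reparam (b := fun s => 1 - s) (by simpa using (hasDerivAt_id t).const_sub 1)
      ((φ 1)⁻¹ p) (Filter.EventuallyEq.of_eq rfl) rfl

/-- The group `Ham(X,σ)` of Hamiltonian diffeomorphisms: the time-one maps of Hamiltonian
isotopies of `(X,σ)`. -/
def ham (σ : DForm E X 2) : Subgroup (Diff E X) where
  carrier := {f | ∃ (H : ℝ → X → ℝ) (φ : ℝ → Diff E X), IsHamiltonianIsotopy σ H φ ∧ φ 1 = f}
  one_mem' := ⟨_, _, .one σ, rfl⟩
  mul_mem' := by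
    rintro _ _ ⟨H, φ, h, rfl⟩ ⟨H', φ', h', rfl⟩
    exact ⟨_, _, h.concat h', concat_one φ φ'⟩
  inv_mem' := by
    rintro _ ⟨H, φ, h, rfl⟩
    exact ⟨_, _, h.inv, by simp [h.zero]⟩

variable (E) in
/-- The group `Ham(X,σ)` of Hamiltonian diffeomorphisms of `X`, viewed as a group of
diffeomorphisms of the cover `π : M → X`: its elements are the time-one maps `φ̃_1` of the lifts
`φ̃_t` (with `φ̃_0 = id`) of the Hamiltonian isotopies `φ_t` of `(X,σ)`. -/
def liftedHam (π : M → X) (σ : DForm E X 2) : Subgroup (Diff E M) where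
  carrier := {f | ∃ (H : ℝ → X → ℝ) (φ : ℝ → Diff E X) (ψ : ℝ → Diff E M),
    IsHamiltonianIsotopy σ H φ ∧ IsLiftedIsotopy π φ ψ ∧ ψ 1 = f}
  one_mem' := ⟨_, _, fun _ => 1, .one σ, ⟨contMDiff_snd, rfl, fun _ _ => rfl⟩, rfl⟩
  mul_mem' := by
    rintro _ _ ⟨H, φ, ψ, h1, h2, rfl⟩ ⟨H', φ', ψ', h1', h2', rfl⟩
    refine ⟨_, concat φ φ', concat ψ ψ', h1.concat h1',
      ⟨contMDiff_concat h2.smooth h2'.smooth, concat_zero h2.zero h2'.zero, fun t m => ?_⟩,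
      concat_one ψ ψ'⟩
    simp [concat, Diff.mul_apply, h2.lift, h2'.lift]
  inv_mem' := by
    rintro _ ⟨H, φ, ψ, h1, h2, rfl⟩
    refine ⟨_, _, fun t => ψ (1 - t) * (ψ 1)⁻¹, h1.inv, ⟨?_, by simp, fun t m => ?_⟩,
      by simp [h2.zero]⟩
    · have h3 : ContMDiff (𝓘(ℝ, ℝ).prod 𝓘(ℝ, E)) 𝓘(ℝ, ℝ) ∞ (fun q : ℝ × M => 1 - q.1) :=
        contMDiff_const.sub contMDiff_fst
      exact h2.smooth.comp (h3.prodMk (((ψ 1)⁻¹ : Diff E M).contMDiff.comp contMDiff_snd))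
    · have h4 : π ((ψ 1)⁻¹ m) = (φ 1)⁻¹ (π m) := by
        apply (φ 1).injective
        change φ 1 (π ((ψ 1)⁻¹ m)) = φ 1 ((φ 1)⁻¹ (π m))
        rw [← h2.lift, Diff.apply_inv, Diff.apply_inv]
      simp [Diff.mul_apply, h2.lift, h4]

/-- A continuous lift of a smooth map through a local diffeomorphism is smooth. -/
theorem smooth_of_lift {EA HA A : Type*} [NormedAddCommGroup EA] [NormedSpace ℝ EA]
    [TopologicalSpace HA] {IA : ModelWithCorners ℝ EA HA} [TopologicalSpace A] [ChartedSpace HA A]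
    {π : M → X} (hπ : IsLocalDiffeomorph 𝓘(ℝ, E) 𝓘(ℝ, E) ∞ π) {F : A → M} (hF : Continuous F)
    (h : ContMDiff IA 𝓘(ℝ, E) ∞ (fun a => π (F a))) : ContMDiff IA 𝓘(ℝ, E) ∞ F := by
  intro a
  obtain ⟨Φ, hm, hΦ⟩ := hπ (F a)
  have h1 : ∀ᶠ b in 𝓝 a, F b ∈ Φ.source := hF.continuousAt (Φ.open_source.mem_nhds hm)
  have h3 : π (F a) ∈ Φ.target := by rw [hΦ hm]; exact Φ.map_source hm
  have h2 : ContMDiffAt IA 𝓘(ℝ, E) ∞ (fun b => Φ.symm (π (F b))) a := by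
    refine ContMDiffAt.comp (x := a) (g := Φ.symm) (f := fun b => π (F b)) ?_ (h a)
    exact (Φ.contMDiffOn_invFun _ h3).contMDiffAt (Φ.open_target.mem_nhds h3)
  refine h2.congr_of_eventuallyEq ?_
  filter_upwards [h1] with b hb
  rw [hΦ hb]
  exact (Φ.left_inv hb).symm

/-- Every isotopy of `X` that starts at the identity lifts to the universal cover. -/
theorem exists_lift {π : M → X} (hπ : IsUniversalCover (E := E) π) {φ : ℝ → Diff E X}
    (hs : ContMDiff (𝓘(ℝ, ℝ).prod 𝓘(ℝ, E)) 𝓘(ℝ, E) ∞ (fun q : ℝ × X => φ q.1 q.2))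
    (h0 : φ 0 = 1) : ∃ ψ : ℝ → Diff E M, IsLiftedIsotopy π φ ψ := by
  have := hπ.simplyConnected
  have : LocallyPathConnectedSpace M := ChartedSpace.locallyPathConnectedSpace E M
  have : SimplyConnectedSpace (ℝ × M) := by
    have e : ContinuousMap.HomotopyEquiv (ℝ × M) (Unit × M) := (ContractibleSpace.hequiv ℝ Unit).some.prodCongr (.refl M)
    have e' : ContinuousMap.HomotopyEquiv (Unit × M) M := (Homeomorph.punitProd M).toHomotopyEquiv
    exact (e.trans e').simplyConnectedSpace
  have hπs : ContMDiff 𝓘(ℝ, E) 𝓘(ℝ, E) ∞ π := hπ.localDiffeo.contMDiff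
  obtain ⟨m₀⟩ : Nonempty M := inferInstance
  have hsm : ContMDiff (𝓘(ℝ, ℝ).prod 𝓘(ℝ, E)) 𝓘(ℝ, E) ∞ (fun q : ℝ × M => φ q.1 (π q.2)) :=
    hs.comp (contMDiff_fst.prodMk (hπs.comp contMDiff_snd))
  obtain ⟨F, ⟨hF0, hF⟩, -⟩ := hπ.covering.existsUnique_continuousMap_lifts
    ⟨fun q : ℝ × M => φ q.1 (π q.2), hsm.continuous⟩ (0, m₀) m₀ (by simp [h0, Diff.one_apply])
  have hF' : ∀ t m, π (F (t, m)) = φ t (π m) := fun t m => congrFun hF (t, m)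
  have hFs := smooth_of_lift hπ.localDiffeo F.continuous
    (h := by simpa [hF'] using hsm)
  have hF1 : ∀ m, F (0, m) = m := by
    have := hπ.covering.eq_of_comp_eq (g₁ := fun m => F (0, m)) (g₂ := id)
      (by fun_prop) continuous_id (by ext m; simp [hF', h0, Diff.one_apply]) m₀ hF0
    exact congrFun this
  have hG : ∀ t : ℝ, ∃ G : C(M, M), G (F (t, m₀)) = m₀ ∧ ∀ m, π (G m) = (φ t)⁻¹ (π m) := by
    intro t
    obtain ⟨G, ⟨h1, h2⟩, -⟩ := hπ.covering.existsUnique_continuousMap_lifts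
      ⟨fun m => (φ t)⁻¹ (π m), ((φ t)⁻¹ : Diff E X).continuous.comp hπs.continuous⟩ (F (t, m₀)) m₀
      (by
        change π m₀ = (φ t)⁻¹ (π (F (t, m₀)))
        rw [hF']; exact ((φ t).symm_apply_apply _).symm)
    exact ⟨G, h1, congrFun h2⟩
  choose G hG0 hG using hG
  have hGF : ∀ t m, G t (F (t, m)) = m := by
    intro t
    have := hπ.covering.eq_of_comp_eq (g₁ := fun m => G t (F (t, m))) (g₂ := id)
      (by fun_prop) continuous_id
      (by ext m; change π (G t (F (t, m))) = π m; rw [hG, hF']; exact (φ t).symm_apply_apply _)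
      m₀ (hG0 t)
    exact congrFun this
  have hFG : ∀ t m, F (t, G t m) = m := by
    intro t
    have := hπ.covering.eq_of_comp_eq (g₁ := fun m => F (t, G t m)) (g₂ := id)
      (by fun_prop) continuous_id
      (by ext m; change π (F (t, G t m)) = π m; rw [hF', hG]; exact (φ t).apply_symm_apply _)
      (F (t, m₀)) (by simp [hG0])
    exact congrFun this
  refine ⟨fun t => ⟨⟨fun m => F (t, m), G t, hGF t, hFG t⟩, ?_, ?_⟩, hFs, ?_, hF'⟩
  · exact hFs.comp (contMDiff_const.prodMk contMDiff_id)
  · refine smooth_of_lift hπ.localDiffeo (G t).continuous ?_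
    have := ((φ t)⁻¹ : Diff E X).contMDiff.comp hπs
    refine this.congr fun m => hG t m
  · exact Diffeomorph.ext hF1
/-- Every Hamiltonian diffeomorphism of `X` is covered by an element of `liftedHam E π σ`. -/
theorem exists_mem_liftedHam {π : M → X} (hπ : IsUniversalCover (E := E) π) {σ : DForm E X 2}
    {f : Diff E X} (hf : f ∈ ham σ) : ∃ g ∈ liftedHam E π σ, ∀ m : M, π (g m) = f (π m) := by
  obtain ⟨H, φ, h, rfl⟩ := hf
  obtain ⟨ψ, hψ⟩ := exists_lift hπ h.smooth h.zero
  exact ⟨ψ 1, ⟨H, φ, ψ, h, hψ, rfl⟩, hψ.lift 1⟩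

end Group

end SympHyp

end

/-! Let `g` be the end `ψ 1` of a lifted isotopy `ψ`. It is Hamiltonian for `pullback π σ`, which is
`d lam`, with Hamiltonian `K t = H t ∘ π`. Cartan's formula gives `∂ₜ(ψₜ^* lam) = d(lam(∂ₜψₜ) + Kₜ ∘
ψₜ)`, because contracting `d lam` with the generating field yields `dKₜ`. Integrating over `[0,1]`,
`g^* lam - lam = dF`, where `F` is the action integral along the orbits of `ψ`
(`hasDerivAt_pullback`, `IsHamiltonianIsotopy.isPrimitive`).

Hence the integral defining the cocycle is `F (h x) - F x` along every path, which gives path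
independence. The identity `(fg)^* lam - lam = g^*(f^* lam - lam) + (g^* lam - lam)` makes `G + F ∘
g` a primitive for `f * g` when `F` and `G` are primitives for `f` and `g` (`IsPrimitive.mul`); the
cocycle relation is then a cancellation.

Semiboundedness follows once `F` is bounded on the whole, possibly noncompact, cover. Both terms of
its integrand are controlled on the compact space `[0,1] × X`: `K` comes from `X`, and `lam` is
bounded by the length of the projected velocity, which is the velocity of the isotopy downstairs
(`exists_actionDensity_bound`). -/

noncomputable section

namespace SympHyp


/-! ### Differentiation under the integral sign -/

section ParametricIntegral

variable {E : Type*} [NormedAddCommGroup E] [NormedSpace ℝ E] [FiniteDimensional ℝ E]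

/-- A continuous function on `ℝ × U` is bounded on `[0,1]` times a neighbourhood of each point of
`U`. -/
theorem exists_nhds_bound {V : Type*} [NormedAddCommGroup V] {G : ℝ × E → V} {U : Set E}
    (hU : IsOpen U) (hG : ContinuousOn G (Set.univ ×ˢ U)) {y₀ : E} (hy : y₀ ∈ U) :
    ∃ s ∈ 𝓝 y₀, s ⊆ U ∧ ∃ C, ∀ t ∈ Set.Icc (0 : ℝ) 1, ∀ y ∈ s, ‖G (t, y)‖ ≤ C := by
  have : ProperSpace E := FiniteDimensional.proper ℝ E
  obtain ⟨K, hK, hKU, hKc⟩ := local_compact_nhds (hU.mem_nhds hy)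
  obtain ⟨C, hC⟩ := (isCompact_Icc.prod hKc).exists_bound_of_continuousOn
    (hG.mono (Set.prod_mono (Set.subset_univ (Set.Icc (0 : ℝ) 1)) hKU))
  exact ⟨K, hK, hKU, C, fun t ht y hyK => hC (t, y) ⟨ht, hyK⟩⟩

theorem continuousOn_prodMk_right {E V : Type*} [TopologicalSpace E] [TopologicalSpace V]
    {G : ℝ × E → V} {U : Set E}
    (hG : ContinuousOn G (Set.univ ×ˢ U)) {y : E} (hy : y ∈ U) :
    Continuous fun t : ℝ => G (t, y) :=
  hG.comp_continuous (by fun_prop) fun _ => ⟨trivial, hy⟩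

theorem continuousOn_parametric_integral {V : Type*} [NormedAddCommGroup V] [NormedSpace ℝ V]
    {G : ℝ × E → V} {U : Set E} (hU : IsOpen U) (hG : ContinuousOn G (Set.univ ×ˢ U)) :
    ContinuousOn (fun y => ∫ t in (0 : ℝ)..1, G (t, y)) U := by
  intro y₀ hy
  obtain ⟨s, hs, hsU, C, hC⟩ := exists_nhds_bound hU hG hy
  refine ContinuousAt.continuousWithinAt ?_
  refine intervalIntegral.continuousAt_of_dominated_interval (bound := fun _ => C) ?_ ?_ (by simp)
    ?_
  · filter_upwards [hs] with y hys
    exact (continuousOn_prodMk_right hG (hsU hys)).aestronglyMeasurable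
  · filter_upwards [hs] with y hys
    refine Filter.Eventually.of_forall fun t ht => hC t ?_ y hys
    rw [Set.uIoc_of_le zero_le_one] at ht
    exact Set.Ioc_subset_Icc_self ht
  · refine Filter.Eventually.of_forall fun t _ => ?_
    have h1 : ContinuousAt G (t, y₀) :=
      hG.continuousAt ((isOpen_univ.prod hU).mem_nhds ⟨trivial, hy⟩)
    exact ContinuousAt.comp (x := y₀) (f := fun y => (t, y)) h1 (by fun_prop)

/-- Dominated convergence applies with a constant bound: the partial derivative in `y` is
continuous, hence bounded on `[0,1]` times a compact neighbourhood of `y₀`. -/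
theorem hasFDerivAt_parametric_integral {V : Type*} [NormedAddCommGroup V] [NormedSpace ℝ V]
    {A : ℝ × E → V} {U : Set E} (hU : IsOpen U) (hA : ContDiffOn ℝ 1 A (Set.univ ×ˢ U))
    {y₀ : E} (hy : y₀ ∈ U) :
    HasFDerivAt (fun y => ∫ t in (0 : ℝ)..1, A (t, y))
      (∫ t in (0 : ℝ)..1, (fderiv ℝ A (t, y₀)).comp (.inr ℝ ℝ E)) y₀ := by
  have hO : IsOpen (Set.univ ×ˢ U : Set (ℝ × E)) := isOpen_univ.prod hU
  have hA' : ContinuousOn (fun q => (fderiv ℝ A q).comp (.inr ℝ ℝ E)) (Set.univ ×ˢ U) :=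
    (hA.continuousOn_fderiv_of_isOpen hO le_rfl).clm_comp continuousOn_const
  obtain ⟨s, hs, hsU, C, hC⟩ := exists_nhds_bound hU hA' hy
  refine intervalIntegral.hasFDerivAt_integral_of_dominated_of_fderiv_le (bound := fun _ => C)
    (F := fun y t => A (t, y)) (F' := fun y t => (fderiv ℝ A (t, y)).comp (.inr ℝ ℝ E)) hs
    ?_ ?_ ?_ ?_ (by simp) ?_
  · filter_upwards [hs] with y hys
    exact (continuousOn_prodMk_right hA.continuousOn (hsU hys)).aestronglyMeasurable
  · exact (continuousOn_prodMk_right hA.continuousOn hy).intervalIntegrable _ _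
  · exact (continuousOn_prodMk_right hA' hy).aestronglyMeasurable
  · refine Filter.Eventually.of_forall fun t ht y hys => hC t ?_ y hys
    rw [Set.uIoc_of_le zero_le_one] at ht
    exact Set.Ioc_subset_Icc_self ht
  · refine Filter.Eventually.of_forall fun t _ y hys => ?_
    have h1 : HasFDerivAt A (fderiv ℝ A (t, y)) (t, y) :=
      ((hA.differentiableOn one_ne_zero).differentiableAt
        (hO.mem_nhds ⟨trivial, hsU hys⟩)).hasFDerivAt
    exact h1.comp y (hasFDerivAt_prodMk_right t y)

theorem contDiffOn_parametric_integral {V : Type*} [NormedAddCommGroup V] [NormedSpace ℝ V]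
    {A : ℝ × E → V} {U : Set E} (hU : IsOpen U) (hA : ContDiffOn ℝ 1 A (Set.univ ×ˢ U)) :
    ContDiffOn ℝ 1 (fun y => ∫ t in (0 : ℝ)..1, A (t, y)) U := by
  have hO : IsOpen (Set.univ ×ˢ U : Set (ℝ × E)) := isOpen_univ.prod hU
  have hA' : ContinuousOn (fun q => (fderiv ℝ A q).comp (.inr ℝ ℝ E)) (Set.univ ×ˢ U) :=
    (hA.continuousOn_fderiv_of_isOpen hO le_rfl).clm_comp continuousOn_const
  have h := fun y (hy : y ∈ U) => hasFDerivAt_parametric_integral hU hA hy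
  rw [← zero_add (1 : WithTop ℕ∞), contDiffOn_succ_iff_fderiv_of_isOpen hU]
  refine ⟨fun y hy => (h y hy).differentiableAt.differentiableWithinAt, by simp, ?_⟩
  exact contDiffOn_zero.2 <| (continuousOn_parametric_integral hU hA').congr
    fun y hy => (h y hy).fderiv

end ParametricIntegral

/-! ### Cartan's formula for pulled back 1-forms on vector spaces -/

section PulledBackForm

variable {V E : Type*} [NormedAddCommGroup V] [NormedSpace ℝ V] [NormedAddCommGroup E]
  [NormedSpace ℝ E]

theorem contDiffAt_pullback_apply {L : E → E [⋀^Fin 1]→L[ℝ] ℝ} {u : V → E} {q : V}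
    (hL : ContDiffAt ℝ ∞ L (u q)) (hu : ContDiffAt ℝ ∞ u q) (e : V) :
    ContDiffAt ℝ ∞ (fun q => L (u q) (fun _ => fderiv ℝ u q e)) q := by
  have h1 : ContDiffAt ℝ ∞ (fun q => fderiv ℝ u q e) q :=
    (hu.fderiv_right (by simp)).clm_apply contDiffAt_const
  -- Alternating 1-forms are identified with the dual space, where evaluation is a smooth bilinear
  -- pairing.
  let e : (E →L[ℝ] ℝ) ≃ₗᵢ[ℝ] (E [⋀^Fin 1]→L[ℝ] ℝ) :=
    ContinuousAlternatingMap.ofSubsingletonLIE (0 : Fin 1)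
  have h2 : ContDiffAt ℝ ∞ (fun q => e.symm (L (u q))) q :=
    e.symm.contDiff.contDiffAt.comp q (hL.comp q hu)
  exact h2.clm_apply h1

/-- Cartan's formula for the exterior derivative of the pullback of a 1-form, along constant
vector fields. -/
theorem fderiv_pullback_sub_fderiv_pullback {L : E → E [⋀^Fin 1]→L[ℝ] ℝ} {u : V → E} {q : V}
    (hL : ContDiffAt ℝ ∞ L (u q)) (hu : ContDiffAt ℝ ∞ u q) (e₁ e₂ : V) :
    fderiv ℝ (fun q => L (u q) (fun _ => fderiv ℝ u q e₂)) q e₁ -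
      fderiv ℝ (fun q => L (u q) (fun _ => fderiv ℝ u q e₁)) q e₂ =
    extDeriv L (u q) ![fderiv ℝ u q e₁, fderiv ℝ u q e₂] := by
  -- The exterior derivative commutes with pullback. Evaluated on constant fields, it has no Lie
  -- bracket term and is an alternating sum of two directional derivatives.
  have h1 := extDeriv_pullback (hL.differentiableAt (by simp)) hu
    (by rw [minSmoothness_of_isRCLikeNormedField]; exact ENat.LEInfty.out)
  have hd : DifferentiableAt ℝ (fun q => (L (u q)).compContinuousLinearMap (fderiv ℝ u q)) q :=
    ((hL.comp q hu).differentiableAt (by simp)).continuousAlternatingMapCompContinuousLinearMap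
      ((hu.fderiv_right (m := ∞) (by simp)).differentiableAt (by simp))
  have h2 := extDeriv_apply hd ![e₁, e₂]
  rw [h1] at h2
  have h3 : (⇑(fderiv ℝ u q) ∘ ![e₁, e₂]) = ![fderiv ℝ u q e₁, fderiv ℝ u q e₂] := by
    ext i; fin_cases i <;> rfl
  rw [ContinuousAlternatingMap.compContinuousLinearMap_apply, h3] at h2
  rw [h2, Fin.sum_univ_two]
  have h4 : (0 : Fin 2).removeNth ![e₁, e₂] = fun _ => e₂ := by
    ext i; fin_cases i; rfl
  have h5 : (1 : Fin 2).removeNth ![e₁, e₂] = fun _ => e₁ := by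
    ext i; fin_cases i; rfl
  rw [h4, h5]
  simp [sub_eq_add_neg, Function.comp_def]

end PulledBackForm

/-! ### Velocity bounds on a compact manifold -/

section Metric

variable {E : Type*} [NormedAddCommGroup E] [NormedSpace ℝ E]
variable {X : Type*} [TopologicalSpace X] [ChartedSpace E X] [IsManifold 𝓘(ℝ, E) ∞ X]

/-- The velocity is the tangent map of `(t, p) ↦ φ t p` applied to the continuous field `(1, 0)` on
`ℝ × X`. -/
theorem continuous_velocity {φ : ℝ → X → X}
    (h : ContMDiff (𝓘(ℝ, ℝ).prod 𝓘(ℝ, E)) 𝓘(ℝ, E) ∞ (fun q : ℝ × X => φ q.1 q.2)) :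
    Continuous fun q : ℝ × X =>
      (⟨φ q.1 q.2, mfderiv 𝓘(ℝ, ℝ) 𝓘(ℝ, E) (fun s => φ s q.2) q.1 (1 : ℝ)⟩ :
      TangentBundle 𝓘(ℝ, E) X) := by
  have h1 := h.continuous_tangentMap (by simp)
  have h2 : Continuous fun t : ℝ => (⟨t, (1 : ℝ)⟩ : TangentBundle 𝓘(ℝ, ℝ) ℝ) :=
    (tangentBundleModelSpaceHomeomorph 𝓘(ℝ, ℝ)).symm.continuous.comp
      (f := fun t : ℝ => ((t, 1) : ModelProd ℝ ℝ)) (by fun_prop)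
  have h3 : Continuous fun p : X => (⟨p, 0⟩ : TangentBundle 𝓘(ℝ, E) X) :=
    (Bundle.contMDiff_zeroSection (n := 0) (IB := 𝓘(ℝ, E)) ℝ
      (TangentSpace 𝓘(ℝ, E) : X → Type _)).continuous
  have h4 := (contMDiff_equivTangentBundleProd_symm (I := 𝓘(ℝ, ℝ)) (M := ℝ) (I' := 𝓘(ℝ, E))
    (M' := X) (n := 0)).continuous
  refine (h1.comp (h4.comp ((h2.comp continuous_fst).prodMk (h3.comp continuous_snd)))).congr ?_
  rintro ⟨t, p⟩
  have h5 : (mfderiv 𝓘(ℝ, ℝ) 𝓘(ℝ, E) (fun s => φ s p) t : ℝ →L[ℝ] E) =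
      (mfderiv (𝓘(ℝ, ℝ).prod 𝓘(ℝ, E)) 𝓘(ℝ, E) (fun q : ℝ × X => φ q.1 q.2) (t, p) :
        ℝ × E →L[ℝ] E).comp (.inl ℝ ℝ E) := by
    have := ((h.mdifferentiableAt (x := (t, p)) (by simp)).hasMFDerivAt.comp t
      (mdifferentiableAt_id.prodMk mdifferentiableAt_const).hasMFDerivAt
      (f := fun s : ℝ => (s, p))).mfderiv
    refine this.trans ?_
    congr 1
    exact mfderiv_prod_left
  have h6 := congrArg (fun L : ℝ →L[ℝ] E => L 1) h5
  exact congrArg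
    (Bundle.TotalSpace.mk' E (E := fun p : X => TangentSpace 𝓘(ℝ, E) p) (φ t p)) h6.symm

/-- The speed is a continuous function on the compact set `[0,1] × X`. -/
theorem exists_speed_bound [CompactSpace X] (ρ : Bundle.ContMDiffRiemannianMetric 𝓘(ℝ, E) ∞ E
      (fun p : X => TangentSpace 𝓘(ℝ, E) p)) {φ : ℝ → X → X}
    (h : ContMDiff (𝓘(ℝ, ℝ).prod 𝓘(ℝ, E)) 𝓘(ℝ, E) ∞ (fun q : ℝ × X => φ q.1 q.2)) :
    ∃ B : ℝ, ∀ t ∈ Set.Icc (0 : ℝ) 1, ∀ p : X,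
      √(ρ.inner (φ t p) (mfderiv 𝓘(ℝ, ℝ) 𝓘(ℝ, E) (fun s => φ s p) t (1 : ℝ))
        (mfderiv 𝓘(ℝ, ℝ) 𝓘(ℝ, E) (fun s => φ s p) t (1 : ℝ))) ≤ B := by
  have hv := continuous_velocity h
  have hb : Continuous fun q : ℝ × X => φ q.1 q.2 := h.continuous
  have hc : Continuous fun q : ℝ × X => (Bundle.TotalSpace.mk' ℝ (E := Bundle.Trivial X ℝ)
      (φ q.1 q.2) (ρ.inner (φ q.1 q.2)
        (mfderiv 𝓘(ℝ, ℝ) 𝓘(ℝ, E) (fun s => φ s q.2) q.1 (1 : ℝ))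
        (mfderiv 𝓘(ℝ, ℝ) 𝓘(ℝ, E) (fun s => φ s q.2) q.1 (1 : ℝ)))) := by
    refine continuous_iff_continuousAt.2 fun q => ?_
    exact ((ρ.contMDiff.continuous.comp hb).continuousAt (x := q)).clm_bundle_apply₂
      (F₁ := E) (F₂ := E) hv.continuousAt hv.continuousAt
  have hc' : Continuous fun q : ℝ × X => √(ρ.inner (φ q.1 q.2)
        (mfderiv 𝓘(ℝ, ℝ) 𝓘(ℝ, E) (fun s => φ s q.2) q.1 (1 : ℝ))
        (mfderiv 𝓘(ℝ, ℝ) 𝓘(ℝ, E) (fun s => φ s q.2) q.1 (1 : ℝ))) := by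
    refine Real.continuous_sqrt.comp (continuous_iff_continuousAt.2 fun q => ?_)
    exact ((FiberBundle.continuousAt_totalSpace _ _).1 hc.continuousAt).2
  obtain ⟨B, hB⟩ := (isCompact_Icc (a := (0 : ℝ)) (b := 1)).prod (isCompact_univ (X := X))
    |>.exists_bound_of_continuousOn hc'.continuousOn
  exact ⟨B, fun t ht p => (le_abs_self _).trans (hB (t, p) ⟨ht, trivial⟩)⟩

end Metric


/-! ### Forms and derivatives in charts -/

section ChartDerivatives

variable {E : Type*} [NormedAddCommGroup E] [NormedSpace ℝ E]
variable {M : Type*} [TopologicalSpace M] [ChartedSpace E M]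

/-- The differentials of the chart and of its inverse cancel, so a form can be recovered from its
chart expression at any point of the chart domain. -/
theorem apply_eq_chartRep [IsManifold 𝓘(ℝ, E) 1 M] {k : ℕ} (α : DForm E M k) {m₀ p : M}
    (hp : p ∈ (extChartAt 𝓘(ℝ, E) m₀).source) (v : Fin k → TangentSpace 𝓘(ℝ, E) p) :
    α p v = chartRep α m₀ (extChartAt 𝓘(ℝ, E) m₀ p)
      (fun i => mfderiv 𝓘(ℝ, E) 𝓘(ℝ, E) (extChartAt 𝓘(ℝ, E) m₀) p (v i)) := by
  have h1 : ∀ (p' : M) (_ : p' = p) (w : Fin k → E), α p' w = α p w := by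
    rintro _ rfl w; rfl
  have h2 := mfderivWithin_extChartAt_symm_comp_mfderiv_extChartAt' (I := 𝓘(ℝ, E)) hp
  rw [modelWithCornersSelf_coe, Set.range_id, mfderivWithin_univ] at h2
  refine Eq.trans ?_ (h1 _ ((extChartAt 𝓘(ℝ, E) m₀).left_inv hp) _).symm
  congr 1
  funext i
  exact (DFunLike.congr_fun h2 (v i)).symm

variable {W : Type*} [NormedAddCommGroup W] [NormedSpace ℝ W] {f : ℝ × M → W}

/-- The expression of `f : ℝ × M → W` in the preferred chart of `M` at `m₀`. -/
def inChart (f : ℝ × M → W) (m₀ : M) : ℝ × E → W :=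
  fun q => f (q.1, (extChartAt 𝓘(ℝ, E) m₀).symm q.2)

theorem contDiffAt_inChart [IsManifold 𝓘(ℝ, E) ∞ M] {m₀ : M} {t : ℝ} {y : E}
    (hy : y ∈ (extChartAt 𝓘(ℝ, E) m₀).target)
    (hf : ContMDiffAt (𝓘(ℝ, ℝ).prod 𝓘(ℝ, E)) 𝓘(ℝ, W) ∞ f
      (t, (extChartAt 𝓘(ℝ, E) m₀).symm y)) :
    ContDiffAt ℝ ∞ (inChart f m₀) (t, y) := by
  rw [← contMDiffAt_iff_contDiffAt]
  have h1 : ContMDiffAt 𝓘(ℝ, E) 𝓘(ℝ, E) ∞ (extChartAt 𝓘(ℝ, E) m₀).symm y :=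
    (contMDiffOn_extChartAt_symm m₀).contMDiffAt
      ((isOpen_extChartAt_target m₀).mem_nhds hy)
  have h2 : ContMDiffAt 𝓘(ℝ, ℝ × E) 𝓘(ℝ, E) ∞
      (fun q : ℝ × E => (extChartAt 𝓘(ℝ, E) m₀).symm q.2) (t, y) :=
    ContMDiffAt.comp (t, y) (f := Prod.snd) h1 contDiff_snd.contMDiff.contMDiffAt
  have h3 : ContMDiffAt 𝓘(ℝ, ℝ × E) 𝓘(ℝ, ℝ) ∞ (Prod.fst : ℝ × E → ℝ) (t, y) :=
    contDiff_fst.contMDiff.contMDiffAt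
  exact ContMDiffAt.comp (t, y) hf (h3.prodMk h2)

theorem fderiv_inChart_time {m₀ : M} {t : ℝ} {y : E}
    (hf : DifferentiableAt ℝ (inChart f m₀) (t, y)) :
    fderiv ℝ (inChart f m₀) (t, y) (1, 0) =
      mfderiv 𝓘(ℝ, ℝ) 𝓘(ℝ, W) (fun s => f (s, (extChartAt 𝓘(ℝ, E) m₀).symm y)) t (1 : ℝ) := by
  rw [mfderiv_eq_fderiv]
  have h := (hf.hasFDerivAt.comp t (f := fun s : ℝ => (s, y)) (hasFDerivAt_prodMk_left t y)).fderiv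
  exact (DFunLike.congr_fun h 1).symm

/-- The base point is the centre `m₀` of the chart because the manifold derivative there is by
definition the derivative in that preferred chart. -/
theorem fderiv_inChart_space {m₀ : M} {t : ℝ}
    (hf : DifferentiableAt ℝ (inChart f m₀) (t, extChartAt 𝓘(ℝ, E) m₀ m₀))
    (hm : MDifferentiableAt 𝓘(ℝ, E) 𝓘(ℝ, W) (fun m => f (t, m)) m₀)
    (v : TangentSpace 𝓘(ℝ, E) m₀) :
    fderiv ℝ (inChart f m₀) (t, extChartAt 𝓘(ℝ, E) m₀ m₀) (0, v) =
      mfderiv 𝓘(ℝ, E) 𝓘(ℝ, W) (fun m => f (t, m)) m₀ v := by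
  rw [hm.mfderiv, modelWithCornersSelf_coe, Set.range_id, fderivWithin_univ]
  have h := (hf.hasFDerivAt.comp _ (f := fun y : E => (t, y))
    (hasFDerivAt_prodMk_right t (extChartAt 𝓘(ℝ, E) m₀ m₀))).fderiv
  exact (DFunLike.congr_fun h v).symm

end ChartDerivatives

/-! ### The action density and the derivative of the pulled back primitive -/

section Action

variable {E : Type*} [NormedAddCommGroup E] [NormedSpace ℝ E]
variable {M : Type*} [TopologicalSpace M] [ChartedSpace E M]
variable {lam : DForm E M 1} {η : DForm E M 2} {K : ℝ → M → ℝ} {ψ : ℝ → Diff E M}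

/-- The integrand `lam(∂_t ψ_t) + K_t ∘ ψ_t` of the action functional. -/
def actionDensity (lam : DForm E M 1) (K : ℝ → M → ℝ) (ψ : ℝ → Diff E M) (q : ℝ × M) : ℝ :=
  lam (ψ q.1 q.2) (fun _ => mfderiv 𝓘(ℝ, ℝ) 𝓘(ℝ, E) (fun s => ψ s q.2) q.1 (1 : ℝ)) +
    K q.1 (ψ q.1 q.2)

/-- The flow `ψ` in the charts at `m₀` and `p₀`. -/
def chartFlow (ψ : ℝ → Diff E M) (m₀ p₀ : M) : ℝ × E → E :=
  inChart (fun q : ℝ × M => extChartAt 𝓘(ℝ, E) p₀ (ψ q.1 q.2)) m₀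

theorem eventually_flow_mem_source
    (h : ContMDiff (𝓘(ℝ, ℝ).prod 𝓘(ℝ, E)) 𝓘(ℝ, E) ∞ (fun q : ℝ × M => ψ q.1 q.2))
    {m₀ p₀ : M} {t : ℝ} {y : E} (hy : y ∈ (extChartAt 𝓘(ℝ, E) m₀).target)
    (hq : ψ t ((extChartAt 𝓘(ℝ, E) m₀).symm y) ∈ (extChartAt 𝓘(ℝ, E) p₀).source) :
    ∀ᶠ q : ℝ × E in 𝓝 (t, y), q.2 ∈ (extChartAt 𝓘(ℝ, E) m₀).target ∧
      ψ q.1 ((extChartAt 𝓘(ℝ, E) m₀).symm q.2) ∈ (extChartAt 𝓘(ℝ, E) p₀).source := by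
  have h1 : ∀ᶠ q : ℝ × E in 𝓝 (t, y), q.2 ∈ (extChartAt 𝓘(ℝ, E) m₀).target :=
    continuousAt_snd.eventually_mem ((isOpen_extChartAt_target m₀).mem_nhds hy)
  have h2 : ContinuousAt (fun q : ℝ × E => (extChartAt 𝓘(ℝ, E) m₀).symm q.2) (t, y) :=
    ContinuousAt.comp (f := Prod.snd) (continuousAt_extChartAt_symm'' hy) continuousAt_snd
  have h3 : ContinuousAt
      (fun q : ℝ × E => ψ q.1 ((extChartAt 𝓘(ℝ, E) m₀).symm q.2)) (t, y) :=
    ContinuousAt.comp (f := fun q : ℝ × E => (q.1, (extChartAt 𝓘(ℝ, E) m₀).symm q.2))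
      h.continuous.continuousAt (continuousAt_fst.prodMk h2)
  exact h1.and (h3.eventually_mem ((isOpen_extChartAt_source p₀).mem_nhds hq))

theorem contDiffAt_chartRep_chartFlow (hlam : IsSmoothForm lam)
    {m₀ p₀ : M} {t : ℝ} {y : E}
    (hq : ψ t ((extChartAt 𝓘(ℝ, E) m₀).symm y) ∈ (extChartAt 𝓘(ℝ, E) p₀).source) :
    ContDiffAt ℝ ∞ (chartRep lam p₀) (chartFlow ψ m₀ p₀ (t, y)) :=
  (hlam p₀).contDiffAt
    ((isOpen_extChartAt_target p₀).mem_nhds ((extChartAt 𝓘(ℝ, E) p₀).map_source hq))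

variable [IsManifold 𝓘(ℝ, E) ∞ M]

theorem contMDiffAt_extChartAt_flow
    (h : ContMDiff (𝓘(ℝ, ℝ).prod 𝓘(ℝ, E)) 𝓘(ℝ, E) ∞ (fun q : ℝ × M => ψ q.1 q.2))
    {p₀ : M} {q : ℝ × M} (hq : ψ q.1 q.2 ∈ (extChartAt 𝓘(ℝ, E) p₀).source) :
    ContMDiffAt (𝓘(ℝ, ℝ).prod 𝓘(ℝ, E)) 𝓘(ℝ, E) ∞
      (fun q : ℝ × M => extChartAt 𝓘(ℝ, E) p₀ (ψ q.1 q.2)) q := by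
  have h1 : ContMDiffAt 𝓘(ℝ, E) 𝓘(ℝ, E) ∞ (extChartAt 𝓘(ℝ, E) p₀) (ψ q.1 q.2) :=
    contMDiffAt_extChartAt' (by simpa using hq)
  exact ContMDiffAt.comp q (f := fun q : ℝ × M => ψ q.1 q.2) h1 h.contMDiffAt

theorem contDiffAt_chartFlow
    (h : ContMDiff (𝓘(ℝ, ℝ).prod 𝓘(ℝ, E)) 𝓘(ℝ, E) ∞ (fun q : ℝ × M => ψ q.1 q.2))
    {m₀ p₀ : M} {t : ℝ} {y : E} (hy : y ∈ (extChartAt 𝓘(ℝ, E) m₀).target)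
    (hq : ψ t ((extChartAt 𝓘(ℝ, E) m₀).symm y) ∈ (extChartAt 𝓘(ℝ, E) p₀).source) :
    ContDiffAt ℝ ∞ (chartFlow ψ m₀ p₀) (t, y) :=
  contDiffAt_inChart hy (contMDiffAt_extChartAt_flow h hq)

/-- With the next lemma, this identifies the two partial derivatives of `chartFlow` with the
velocity and the space differential of the flow, so that Cartan's formula on `ℝ × E` can be applied.
-/
theorem mfderiv_extChartAt_velocity
    (h : ContMDiff (𝓘(ℝ, ℝ).prod 𝓘(ℝ, E)) 𝓘(ℝ, E) ∞ (fun q : ℝ × M => ψ q.1 q.2))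
    {m₀ p₀ : M} {t : ℝ} {y : E} (hy : y ∈ (extChartAt 𝓘(ℝ, E) m₀).target)
    (hq : ψ t ((extChartAt 𝓘(ℝ, E) m₀).symm y) ∈ (extChartAt 𝓘(ℝ, E) p₀).source) :
    mfderiv 𝓘(ℝ, E) 𝓘(ℝ, E) (extChartAt 𝓘(ℝ, E) p₀) (ψ t ((extChartAt 𝓘(ℝ, E) m₀).symm y))
      (mfderiv 𝓘(ℝ, ℝ) 𝓘(ℝ, E) (fun s => ψ s ((extChartAt 𝓘(ℝ, E) m₀).symm y)) t (1 : ℝ)) =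
    fderiv ℝ (chartFlow ψ m₀ p₀) (t, y) (1, 0) := by
  refine Eq.trans ?_
    (fderiv_inChart_time ((contDiffAt_chartFlow h hy hq).differentiableAt (by simp))).symm
  have h1 : MDifferentiableAt 𝓘(ℝ, ℝ) 𝓘(ℝ, E)
      (fun s => ψ s ((extChartAt 𝓘(ℝ, E) m₀).symm y)) t :=
    (h.comp (contMDiff_id.prodMk contMDiff_const)).mdifferentiableAt (by simp)
  have h2 : MDifferentiableAt 𝓘(ℝ, E) 𝓘(ℝ, E) (extChartAt 𝓘(ℝ, E) p₀)
      (ψ t ((extChartAt 𝓘(ℝ, E) m₀).symm y)) := mdifferentiableAt_extChartAt (by simpa using hq)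
  exact (DFunLike.congr_fun (mfderiv_comp t h2 h1) (1 : ℝ)).symm

theorem mfderiv_extChartAt_mfderiv_flow
    (h : ContMDiff (𝓘(ℝ, ℝ).prod 𝓘(ℝ, E)) 𝓘(ℝ, E) ∞ (fun q : ℝ × M => ψ q.1 q.2))
    {m₀ p₀ : M} {t : ℝ} (hq : ψ t m₀ ∈ (extChartAt 𝓘(ℝ, E) p₀).source)
    (v : TangentSpace 𝓘(ℝ, E) m₀) :
    mfderiv 𝓘(ℝ, E) 𝓘(ℝ, E) (extChartAt 𝓘(ℝ, E) p₀) (ψ t m₀)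
      (mfderiv 𝓘(ℝ, E) 𝓘(ℝ, E) (ψ t) m₀ v) =
    fderiv ℝ (chartFlow ψ m₀ p₀) (t, extChartAt 𝓘(ℝ, E) m₀ m₀) (0, v) := by
  have h1 : MDifferentiableAt 𝓘(ℝ, E) 𝓘(ℝ, E) (ψ t) m₀ :=
    (ψ t).contMDiff.mdifferentiableAt (by simp)
  have h2 : MDifferentiableAt 𝓘(ℝ, E) 𝓘(ℝ, E) (extChartAt 𝓘(ℝ, E) p₀) (ψ t m₀) :=
    mdifferentiableAt_extChartAt (by simpa using hq)
  refine Eq.trans ?_ (fderiv_inChart_space (W := E)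
    (f := fun q : ℝ × M => extChartAt 𝓘(ℝ, E) p₀ (ψ q.1 q.2)) ?_ (h2.comp m₀ h1) v).symm
  · exact (DFunLike.congr_fun (mfderiv_comp m₀ h2 h1) v).symm
  · exact (contDiffAt_chartFlow h (mem_extChartAt_target m₀)
      (by rwa [extChartAt_to_inv])).differentiableAt (by simp)

/-- The local expression of the action density. -/
theorem inChart_actionDensity_eventuallyEq
    (h : ContMDiff (𝓘(ℝ, ℝ).prod 𝓘(ℝ, E)) 𝓘(ℝ, E) ∞ (fun q : ℝ × M => ψ q.1 q.2))
    {m₀ p₀ : M} {t : ℝ} {y : E} (hy : y ∈ (extChartAt 𝓘(ℝ, E) m₀).target)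
    (hq : ψ t ((extChartAt 𝓘(ℝ, E) m₀).symm y) ∈ (extChartAt 𝓘(ℝ, E) p₀).source) :
    inChart (actionDensity lam K ψ) m₀ =ᶠ[𝓝 (t, y)] fun q =>
      chartRep lam p₀ (chartFlow ψ m₀ p₀ q) (fun _ => fderiv ℝ (chartFlow ψ m₀ p₀) q (1, 0)) +
        inChart (fun q : ℝ × M => K q.1 (ψ q.1 q.2)) m₀ q := by
  filter_upwards [eventually_flow_mem_source h hy hq] with q ⟨h1, h2⟩
  refine congrArg (· + _) ((apply_eq_chartRep lam h2 _).trans ?_)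
  rw [mfderiv_extChartAt_velocity h h1 h2]
  rfl

theorem contDiffAt_inChart_ham (hψ : IsHamiltonianIsotopy η K ψ)
    {m₀ : M} {t : ℝ} {y : E} (hy : y ∈ (extChartAt 𝓘(ℝ, E) m₀).target) :
    ContDiffAt ℝ ∞ (inChart (fun q : ℝ × M => K q.1 (ψ q.1 q.2)) m₀) (t, y) :=
  contDiffAt_inChart hy (hψ.smooth_ham.comp (contMDiff_fst.prodMk hψ.smooth)).contMDiffAt

theorem contDiffOn_inChart_actionDensity (hψ : IsHamiltonianIsotopy η K ψ)
    (hlam : IsSmoothForm lam) (m₀ : M) :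
    ContDiffOn ℝ ∞ (inChart (actionDensity lam K ψ) m₀)
      (Set.univ ×ˢ (extChartAt 𝓘(ℝ, E) m₀).target) := by
  rintro ⟨t, y⟩ ⟨-, hy⟩
  -- Smoothness is local, so the target chart may be centred at the image of the point considered.
  have hq := mem_extChartAt_source (I := 𝓘(ℝ, E)) (ψ t ((extChartAt 𝓘(ℝ, E) m₀).symm y))
  refine ContDiffAt.contDiffWithinAt ?_
  refine ContDiffAt.congr_of_eventuallyEq ?_ (inChart_actionDensity_eventuallyEq hψ.smooth hy hq)
  exact (contDiffAt_pullback_apply (contDiffAt_chartRep_chartFlow hlam hq)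
    (contDiffAt_chartFlow hψ.smooth hy hq) (1, 0)).add (contDiffAt_inChart_ham hψ hy)

/-- `∂_t (ψ_t^* lam) = d (lam(∂_t ψ_t) + K_t ∘ ψ_t)` for the Hamiltonian isotopy `ψ` of an exact
form `η = d lam`. -/
theorem hasDerivAt_pullback (hψ : IsHamiltonianIsotopy η K ψ)
    (hlam : IsSmoothForm lam) (hd : IsExteriorDerivative lam η) (m₀ : M) (t : ℝ)
    (v : TangentSpace 𝓘(ℝ, E) m₀) :
    HasDerivAt (fun s => pullback (ψ s) lam m₀ (fun _ => v))
      (fderiv ℝ (inChart (actionDensity lam K ψ) m₀) (t, extChartAt 𝓘(ℝ, E) m₀ m₀) (0, v)) t := by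
  set p₀ := ψ t m₀ with hp₀
  set y₀ := extChartAt 𝓘(ℝ, E) m₀ m₀ with hy₀
  set u := chartFlow ψ m₀ p₀ with hu
  set L := chartRep lam p₀ with hL
  have hy : y₀ ∈ (extChartAt 𝓘(ℝ, E) m₀).target := mem_extChartAt_target m₀
  have hm : (extChartAt 𝓘(ℝ, E) m₀).symm y₀ = m₀ := extChartAt_to_inv m₀
  have hp : ψ t m₀ ∈ (extChartAt 𝓘(ℝ, E) p₀).source := mem_extChartAt_source _
  have hq : ψ t ((extChartAt 𝓘(ℝ, E) m₀).symm y₀) ∈ (extChartAt 𝓘(ℝ, E) p₀).source := by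
    rwa [hm]
  have hcL := contDiffAt_chartRep_chartFlow (t := t) (y := y₀) hlam hq
  have hcu := contDiffAt_chartFlow hψ.smooth hy hq
  have hcK := contDiffAt_inChart_ham (t := t) hψ hy
  have ha := contDiffAt_pullback_apply hcL hcu (1, 0)
  have hb := contDiffAt_pullback_apply hcL hcu (0, v)
  have hut : u (t, y₀) = extChartAt 𝓘(ℝ, E) p₀ p₀ :=
    congrArg (fun m => extChartAt 𝓘(ℝ, E) p₀ (ψ t m)) hm
  have hvel := mfderiv_extChartAt_velocity hψ.smooth hy hq
  rw [hm] at hvel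
  -- Hamilton's equation read in charts: `d lam (∂ₜψ, dψ v) = d(Kₜ ∘ ψₜ) v`.
  have hη : extDeriv L (u (t, y₀)) ![fderiv ℝ u (t, y₀) (1, 0), fderiv ℝ u (t, y₀) (0, v)] =
      fderiv ℝ (inChart (fun q : ℝ × M => K q.1 (ψ q.1 q.2)) m₀) (t, y₀) (0, v) := by
    rw [hut, hd p₀ _ (mem_extChartAt_target p₀)]
    have h1 := hψ.hamilton t m₀ (mfderiv 𝓘(ℝ, E) 𝓘(ℝ, E) (ψ t) m₀ v)
    rw [apply_eq_chartRep η hp] at h1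
    have hKt : MDifferentiableAt 𝓘(ℝ, E) 𝓘(ℝ, ℝ) (K t) (ψ t m₀) :=
      (hψ.smooth_ham.comp (contMDiff_const.prodMk contMDiff_id)).mdifferentiableAt (by simp)
    have hψt : MDifferentiableAt 𝓘(ℝ, E) 𝓘(ℝ, E) (ψ t) m₀ :=
      (ψ t).contMDiff.mdifferentiableAt (by simp)
    rw [fderiv_inChart_space (hcK.differentiableAt (by simp)) (hKt.comp m₀ hψt) v]
    refine Eq.trans ?_ (h1.trans (DFunLike.congr_fun (mfderiv_comp m₀ hKt hψt) v).symm)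
    congr 1
    funext i
    fin_cases i
    · exact hvel.symm
    · exact (mfderiv_extChartAt_mfderiv_flow hψ.smooth hp v).symm
  have hcartan := fderiv_pullback_sub_fderiv_pullback hcL hcu (1, 0) (0, v)
  have hA : fderiv ℝ (inChart (actionDensity lam K ψ) m₀) (t, y₀) (0, v) =
      -- Cartan's formula exchanges the `t` and `v` derivatives up to `d lam (∂ₜψ, dψ v)`, and by
      -- `hη` this error is exactly the derivative of the Hamiltonian term.
      fderiv ℝ (fun q => L (u q) (fun _ => fderiv ℝ u q (0, v))) (t, y₀) (1, 0) := by
    rw [(inChart_actionDensity_eventuallyEq hψ.smooth hy hq).fderiv_eq,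
      fderiv_fun_add (ha.differentiableAt (by simp)) (hcK.differentiableAt (by simp))]
    exact (sub_eq_iff_eq_add'.1 (hcartan.trans hη)).symm
  rw [hA]
  have h1 : HasDerivAt (fun s => L (u (s, y₀)) (fun _ => fderiv ℝ u (s, y₀) (0, v)))
      (fderiv ℝ (fun q => L (u q) (fun _ => fderiv ℝ u q (0, v))) (t, y₀) (1, 0)) t :=
    ((hb.differentiableAt (by simp)).hasFDerivAt.comp t
      (f := fun s : ℝ => (s, y₀)) (hasFDerivAt_prodMk_left t y₀)).hasDerivAt
  refine h1.congr_of_eventuallyEq ?_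
  -- For `s` near `t` the orbit stays in the chart at `p₀`, where the pullback agrees with its local
  -- expression.
  have h2 : ContinuousAt (fun s : ℝ => ψ s m₀) t :=
    (hψ.smooth.continuous.comp (Continuous.prodMk_left m₀)).continuousAt
  filter_upwards [h2.eventually_mem ((isOpen_extChartAt_source p₀).mem_nhds hp)] with s hs
  have h3 : u (s, y₀) = extChartAt 𝓘(ℝ, E) p₀ (ψ s m₀) :=
    congrArg (fun m => extChartAt 𝓘(ℝ, E) p₀ (ψ s m)) hm
  rw [h3, ← mfderiv_extChartAt_mfderiv_flow hψ.smooth hs v]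
  exact apply_eq_chartRep lam hs (fun _ => mfderiv 𝓘(ℝ, E) 𝓘(ℝ, E) (ψ s) m₀ v)

end Action


/-! ### Primitives, path integrals and composition -/

section Primitive

variable {E : Type*} [NormedAddCommGroup E] [NormedSpace ℝ E]
variable {M : Type*} [TopologicalSpace M] [ChartedSpace E M]

/-- `F` is a `C¹` function with `dF = α`. -/
structure IsPrimitive (F : M → ℝ) (α : DForm E M 1) : Prop where
  contMDiff : ContMDiff 𝓘(ℝ, E) 𝓘(ℝ, ℝ) 1 F
  mfderiv_eq : ∀ (m : M) (v : TangentSpace 𝓘(ℝ, E) m),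
    mfderiv 𝓘(ℝ, E) 𝓘(ℝ, ℝ) F m v = α m (fun _ => v)

/-- The fundamental theorem of calculus for `F ∘ γ`, with derivatives taken within `[0,1]` since `γ`
is only controlled there. -/
theorem IsPrimitive.pathIntegral_eq {F : M → ℝ} {α : DForm E M 1} (hF : IsPrimitive F α)
    {γ : ℝ → M} {y z : M} (hγ : IsPathFromTo (E := E) γ y z) :
    pathIntegral α γ = F z - F y := by
  obtain ⟨h1, rfl, rfl⟩ := hγ
  have h2 : ContDiffOn ℝ 1 (F ∘ γ) (Set.Icc 0 1) :=
    contMDiffOn_iff_contDiffOn.1 (hF.contMDiff.comp_contMDiffOn h1)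
  have h3 := intervalIntegral.integral_derivWithin_Icc_of_contDiffOn_Icc h2 zero_le_one
  refine Eq.trans (intervalIntegral.integral_congr fun t ht => ?_) h3
  rw [Set.uIcc_of_le zero_le_one] at ht
  have h4 : MDifferentiableAt 𝓘(ℝ, E) 𝓘(ℝ, ℝ) F (γ t) :=
    hF.contMDiff.mdifferentiableAt one_ne_zero
  have h5 : MDifferentiableWithinAt 𝓘(ℝ, ℝ) 𝓘(ℝ, E) γ (Set.Icc 0 1) t :=
    (h1 t ht).mdifferentiableWithinAt one_ne_zero
  have h6 : UniqueMDiffWithinAt 𝓘(ℝ, ℝ) (Set.Icc (0 : ℝ) 1) t :=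
    ((uniqueDiffOn_Icc zero_lt_one) t ht).uniqueMDiffWithinAt
  have h7 := DFunLike.congr_fun (mfderiv_comp_mfderivWithin t h4 h5 h6) (1 : ℝ)
  refine (hF.mfderiv_eq (γ t) _).symm.trans (h7.symm.trans ?_)
  rw [mfderivWithin_eq_fderivWithin]
  rfl

theorem IsPrimitive.cocycleG_eq {F : M → ℝ} {lam : DForm E M 1} {g h : Diff E M} {x : M}
    (hF : IsPrimitive F (pullback g lam - lam))
    (hp : ∃ γ : ℝ → M, IsPathFromTo (E := E) γ x (h x)) :
    cocycleG x lam g h = F (h x) - F x := by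
  rw [cocycleG, dif_pos hp]
  exact hF.pathIntegral_eq hp.choose_spec

/-- This is `(fg)^* lam - lam = g^*(f^* lam - lam) + (g^* lam - lam)` together with `g^* dF = d(F ∘
g)`. -/
theorem IsPrimitive.mul {F G : M → ℝ} {lam : DForm E M 1} {f g : Diff E M}
    (hF : IsPrimitive F (pullback f lam - lam)) (hG : IsPrimitive G (pullback g lam - lam)) :
    IsPrimitive (fun m => G m + F (g m)) (pullback (f * g : Diff E M) lam - lam) where
  contMDiff := hG.contMDiff.add (hF.contMDiff.comp (g.contMDiff.of_le ENat.LEInfty.out))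
  mfderiv_eq m v := by
    have hg : MDifferentiableAt 𝓘(ℝ, E) 𝓘(ℝ, E) g m := g.contMDiff.mdifferentiableAt (by simp)
    have hf : MDifferentiableAt 𝓘(ℝ, E) 𝓘(ℝ, E) f (g m) :=
      f.contMDiff.mdifferentiableAt (by simp)
    have hF' : MDifferentiableAt 𝓘(ℝ, E) 𝓘(ℝ, ℝ) F (g m) :=
      hF.contMDiff.mdifferentiableAt one_ne_zero
    have hG' : MDifferentiableAt 𝓘(ℝ, E) 𝓘(ℝ, ℝ) G m :=
      hG.contMDiff.mdifferentiableAt one_ne_zero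
    have h1 : ∀ a b : ℝ, mfderiv 𝓘(ℝ, E) 𝓘(ℝ, ℝ) G m v = a →
        mfderiv 𝓘(ℝ, E) 𝓘(ℝ, ℝ) F (g m) (mfderiv 𝓘(ℝ, E) 𝓘(ℝ, E) g m v) = b →
        mfderiv 𝓘(ℝ, E) 𝓘(ℝ, ℝ) (fun m => G m + F (g m)) m v = a + b := by
      rintro _ _ rfl rfl
      exact DFunLike.congr_fun
        (hG'.hasMFDerivAt.add (hF'.hasMFDerivAt.comp m hg.hasMFDerivAt)).mfderiv v
    have h2 : mfderiv 𝓘(ℝ, E) 𝓘(ℝ, E) (f * g : Diff E M) m v =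
        mfderiv 𝓘(ℝ, E) 𝓘(ℝ, E) f (g m) (mfderiv 𝓘(ℝ, E) 𝓘(ℝ, E) g m v) :=
      DFunLike.congr_fun (mfderiv_comp m hf hg) v
    have h3 : (pullback (f * g : Diff E M) lam - lam) m (fun _ => v) =
        lam (f (g m)) (fun _ => mfderiv 𝓘(ℝ, E) 𝓘(ℝ, E) (f * g : Diff E M) m v) -
          lam m (fun _ => v) := rfl
    have h4 : (pullback f lam - lam) (g m) (fun _ => mfderiv 𝓘(ℝ, E) 𝓘(ℝ, E) g m v) =
        lam (f (g m)) (fun _ => mfderiv 𝓘(ℝ, E) 𝓘(ℝ, E) f (g m)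
          (mfderiv 𝓘(ℝ, E) 𝓘(ℝ, E) g m v)) -
        lam (g m) (fun _ => mfderiv 𝓘(ℝ, E) 𝓘(ℝ, E) g m v) := rfl
    have h5 : (pullback g lam - lam) m (fun _ => v) =
        lam (g m) (fun _ => mfderiv 𝓘(ℝ, E) 𝓘(ℝ, E) g m v) - lam m (fun _ => v) := rfl
    rw [h1 _ _ (hG.mfderiv_eq m v) (hF.mfderiv_eq (g m) _), h3, h4, h5, h2]
    exact sub_add_sub_cancel' _ _ _

end Primitive

/-! ### The action integral as a primitive -/

section ActionIntegral

section Bound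

variable {E : Type*} [NormedAddCommGroup E] [NormedSpace ℝ E]
variable {M : Type*} [TopologicalSpace M] [ChartedSpace E M]
variable {lam : DForm E M 1} {K : ℝ → M → ℝ} {ψ : ℝ → Diff E M}

theorem abs_actionIntegral_le {B : ℝ}
    (hB : ∀ t ∈ Set.Icc (0 : ℝ) 1, ∀ m, |actionDensity lam K ψ (t, m)| ≤ B) (m : M) :
    |∫ t in (0 : ℝ)..1, actionDensity lam K ψ (t, m)| ≤ B := by
  have h := intervalIntegral.norm_integral_le_of_norm_le_const (a := (0 : ℝ)) (b := 1) (C := B)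
    (f := fun t => actionDensity lam K ψ (t, m)) fun t ht => by
      rw [Set.uIoc_of_le zero_le_one] at ht
      exact hB t (Set.Ioc_subset_Icc_self ht) m
  simpa using h

end Bound

variable {E : Type*} [NormedAddCommGroup E] [NormedSpace ℝ E] [FiniteDimensional ℝ E]
variable {M : Type*} [TopologicalSpace M] [ChartedSpace E M] [IsManifold 𝓘(ℝ, E) ∞ M]
variable {lam : DForm E M 1} {η : DForm E M 2} {K : ℝ → M → ℝ} {ψ : ℝ → Diff E M}

/-- The time-one map of the Hamiltonian isotopy `ψ` of an exact form `η = d lam` changes `lam` by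
the differential of the action integral. -/
theorem IsHamiltonianIsotopy.isPrimitive (hψ : IsHamiltonianIsotopy η K ψ)
    (hlam : IsSmoothForm lam) (hd : IsExteriorDerivative lam η) :
    IsPrimitive (fun m => ∫ t in (0 : ℝ)..1, actionDensity lam K ψ (t, m))
      (pullback (ψ 1) lam - lam) := by
  set F : M → ℝ := fun m => ∫ t in (0 : ℝ)..1, actionDensity lam K ψ (t, m) with hF
  have hA (m : M) := (contDiffOn_inChart_actionDensity hψ hlam m).of_le
    (ENat.LEInfty.out (m := 1))
  have hU (m : M) := isOpen_extChartAt_target (I := 𝓘(ℝ, E)) m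
  have hy (m : M) := mem_extChartAt_target (I := 𝓘(ℝ, E)) m
  have hc : ContMDiff 𝓘(ℝ, E) 𝓘(ℝ, ℝ) 1 F := by
    intro m
    have h1 : ContMDiffAt 𝓘(ℝ, E) 𝓘(ℝ, ℝ) 1
        (fun y => ∫ t in (0 : ℝ)..1, inChart (actionDensity lam K ψ) m (t, y))
        (extChartAt 𝓘(ℝ, E) m m) :=
      ((contDiffOn_parametric_integral (hU m) (hA m)).contDiffAt
        ((hU m).mem_nhds (hy m))).contMDiffAt
    refine (h1.comp m contMDiffAt_extChartAt).congr_of_eventuallyEq ?_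
    filter_upwards [extChartAt_source_mem_nhds (I := 𝓘(ℝ, E)) m] with m' hm'
    simp only [hF, Function.comp_apply, inChart, (extChartAt 𝓘(ℝ, E) m).left_inv hm']
  refine ⟨hc, fun m v => ?_⟩
  have h1 := hasFDerivAt_parametric_integral (hU m) (hA m) (hy m)
  have h2 : HasFDerivAt (writtenInExtChartAt 𝓘(ℝ, E) 𝓘(ℝ, ℝ) m F)
      (∫ t in (0 : ℝ)..1, (fderiv ℝ (inChart (actionDensity lam K ψ) m)
        (t, extChartAt 𝓘(ℝ, E) m m)).comp (.inr ℝ ℝ E)) (extChartAt 𝓘(ℝ, E) m m) := h1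
  have hcont : Continuous fun t : ℝ => fderiv ℝ (inChart (actionDensity lam K ψ) m)
      (t, extChartAt 𝓘(ℝ, E) m m) :=
    continuousOn_prodMk_right
      ((hA m).continuousOn_fderiv_of_isOpen (isOpen_univ.prod (hU m)) le_rfl) (hy m)
  have h3 : mfderiv 𝓘(ℝ, E) 𝓘(ℝ, ℝ) F m v = ∫ t in (0 : ℝ)..1,
      fderiv ℝ (inChart (actionDensity lam K ψ) m) (t, extChartAt 𝓘(ℝ, E) m m) (0, v) := by
    rw [(hc.mdifferentiableAt one_ne_zero).mfderiv, modelWithCornersSelf_coe, Set.range_id,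
      fderivWithin_univ, h2.fderiv]
    exact ContinuousLinearMap.intervalIntegral_apply (E := ℝ) (F := E)
      ((hcont.clm_comp continuous_const).intervalIntegrable _ _) v
  -- The differential of the density is the time derivative of `ψₜ^* lam`, so its integral is the
  -- difference of the values at `1` and `0`; the latter is `lam` because `ψ 0` is the identity.
  rw [h3, intervalIntegral.integral_eq_sub_of_hasDerivAt
    (fun t _ => hasDerivAt_pullback hψ hlam hd m t v)
    ((hcont.clm_apply continuous_const).intervalIntegrable _ _)]
  have h4 : pullback (ψ 0) lam m (fun _ => v) = lam m (fun _ => v) := by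
    rw [hψ.zero]
    have h5 : mfderiv 𝓘(ℝ, E) 𝓘(ℝ, E) (1 : Diff E M) m = .id ℝ _ := mfderiv_id
    exact congrArg (fun L : E →L[ℝ] E => lam m (fun _ => L v)) h5
  rw [h4]
  rfl

end ActionIntegral

/-! ### Lifted isotopies and the bound on the action density -/

section Lift

variable {E : Type*} [NormedAddCommGroup E] [NormedSpace ℝ E]
variable {X : Type*} [TopologicalSpace X] [ChartedSpace E X]
variable {M : Type*} [TopologicalSpace M] [ChartedSpace E M]
variable {π : M → X} {σ : DForm E X 2} {H : ℝ → X → ℝ} {φ : ℝ → Diff E X} {ψ : ℝ → Diff E M}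

theorem IsLiftedIsotopy.mfderiv_velocity (hπ : ContMDiff 𝓘(ℝ, E) 𝓘(ℝ, E) ∞ π)
    (hψ : IsLiftedIsotopy π φ ψ) (t : ℝ) (m : M) :
    (mfderiv 𝓘(ℝ, E) 𝓘(ℝ, E) π (ψ t m)
      (mfderiv 𝓘(ℝ, ℝ) 𝓘(ℝ, E) (fun s => ψ s m) t (1 : ℝ)) : E) =
    mfderiv 𝓘(ℝ, ℝ) 𝓘(ℝ, E) (fun s => φ s (π m)) t (1 : ℝ) := by
  have h1 : MDifferentiableAt 𝓘(ℝ, ℝ) 𝓘(ℝ, E) (fun s => ψ s m) t :=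
    (hψ.smooth.comp (contMDiff_id.prodMk contMDiff_const)).mdifferentiableAt (by simp)
  have h2 : MDifferentiableAt 𝓘(ℝ, E) 𝓘(ℝ, E) π (ψ t m) := hπ.mdifferentiableAt (by simp)
  have h3 : (π ∘ fun s => ψ s m) = fun s => φ s (π m) := funext fun s => hψ.lift s m
  rw [← h3]
  exact (DFunLike.congr_fun (mfderiv_comp t h2 h1) (1 : ℝ)).symm

/-- The lift of a Hamiltonian isotopy is a Hamiltonian isotopy of the pulled back form. -/
theorem IsHamiltonianIsotopy.lift (h : IsHamiltonianIsotopy σ H φ)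
    (hπ : ContMDiff 𝓘(ℝ, E) 𝓘(ℝ, E) ∞ π) (hψ : IsLiftedIsotopy π φ ψ) :
    IsHamiltonianIsotopy (pullback π σ) (fun t m => H t (π m)) ψ where
  smooth_ham := h.smooth_ham.comp (contMDiff_fst.prodMk (hπ.comp contMDiff_snd))
  smooth := hψ.smooth
  zero := hψ.zero
  hamilton t m v := by
    -- The base point is left free because `φ t (π m)` and `π (ψ t m)` are equal only through
    -- `hψ.lift`, while the vectors live in tangent spaces that depend on it.
    have h1 : ∀ (p' : X) (_ : φ t (π m) = p') (w : E),
        σ p' ![(mfderiv 𝓘(ℝ, ℝ) 𝓘(ℝ, E) (fun s => φ s (π m)) t (1 : ℝ) : E), w] =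
          mfderiv 𝓘(ℝ, E) 𝓘(ℝ, ℝ) (H t) p' w := by
      rintro _ rfl w
      exact h.hamilton t (π m) w
    have hH : MDifferentiableAt 𝓘(ℝ, E) 𝓘(ℝ, ℝ) (H t) (π (ψ t m)) :=
      (h.smooth_ham.comp (contMDiff_const.prodMk contMDiff_id)).mdifferentiableAt (by simp)
    have h2 := h1 _ (hψ.lift t m).symm (mfderiv 𝓘(ℝ, E) 𝓘(ℝ, E) π (ψ t m) v)
    rw [← hψ.mfderiv_velocity hπ t m] at h2
    refine Eq.trans ?_ (h2.trans
      (DFunLike.congr_fun (mfderiv_comp (ψ t m) hH (hπ.mdifferentiableAt (by simp))) v).symm)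
    refine congrArg (σ (π (ψ t m))) ?_
    funext i
    fin_cases i <;> rfl

variable [IsManifold 𝓘(ℝ, E) ∞ X] [CompactSpace X]

/-- Compactness of the cover is not needed: the bound on `lam` sees a velocity only through `dπ`,
and the projected velocity belongs to `φ` on the compact base. -/
theorem exists_actionDensity_bound {lam : DForm E M 1} (hlam : IsBoundedPrimitive π σ lam)
    (h : IsHamiltonianIsotopy σ H φ) (hπ : ContMDiff 𝓘(ℝ, E) 𝓘(ℝ, E) ∞ π)
    (hψ : IsLiftedIsotopy π φ ψ) :
    ∃ B : ℝ, ∀ t ∈ Set.Icc (0 : ℝ) 1, ∀ m,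
      |actionDensity lam (fun t m => H t (π m)) ψ (t, m)| ≤ B := by
  obtain ⟨ρ, C, hC⟩ := hlam.bounded
  obtain ⟨B₁, hB₁⟩ := exists_speed_bound (φ := fun t => φ t) ρ h.smooth
  obtain ⟨B₂, hB₂⟩ := (isCompact_Icc (a := (0 : ℝ)) (b := 1)).prod (isCompact_univ (X := X))
    |>.exists_bound_of_continuousOn h.smooth_ham.continuous.continuousOn
  -- The constant `C` carries no sign condition, hence `|C|`.
  refine ⟨|C| * B₁ + B₂, fun t ht m => (abs_add_le _ _).trans (add_le_add ?_ ?_)⟩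
  · refine (hC _ _).trans ?_
    have h1 : ∀ (p' : X) (_ : φ t (π m) = p') (w : E)
        (_ : mfderiv 𝓘(ℝ, ℝ) 𝓘(ℝ, E) (fun s => φ s (π m)) t (1 : ℝ) = w),
        √(ρ.inner p' w w) ≤ B₁ := by
      rintro _ rfl _ rfl
      exact hB₁ t ht (π m)
    have h2 := h1 _ (hψ.lift t m).symm _ (hψ.mfderiv_velocity hπ t m).symm
    exact mul_le_mul (le_abs_self C) h2 (Real.sqrt_nonneg _) (abs_nonneg C)
  · exact hB₂ (t, π (ψ t m)) ⟨ht, trivial⟩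

end Lift

/-! ### Paths and bounded primitives for the lifted group -/

section LiftedHam

variable {E : Type*} [NormedAddCommGroup E] [NormedSpace ℝ E]
variable {X : Type*} [TopologicalSpace X] [ChartedSpace E X]
variable {M : Type*} [TopologicalSpace M] [ChartedSpace E M]
variable {π : M → X} {σ : DForm E X 2}

theorem exists_path_of_mem_liftedHam {h : Diff E M} (hh : h ∈ liftedHam E π σ) (x : M) :
    ∃ γ : ℝ → M, IsPathFromTo (E := E) γ x (h x) := by
  obtain ⟨H, φ, ψ, -, hψ, rfl⟩ := hh
  -- The orbit of `x` under the isotopy is the required path.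
  refine ⟨fun t => ψ t x, ContMDiff.contMDiffOn ?_, by simp [hψ.zero, Diff.one_apply], rfl⟩
  exact (hψ.smooth.comp (contMDiff_id.prodMk contMDiff_const)).of_le ENat.LEInfty.out

variable [FiniteDimensional ℝ E] [IsManifold 𝓘(ℝ, E) ∞ X] [CompactSpace X]
  [IsManifold 𝓘(ℝ, E) ∞ M]

theorem exists_bounded_primitive (hπ : ContMDiff 𝓘(ℝ, E) 𝓘(ℝ, E) ∞ π) {lam : DForm E M 1}
    (hlam : IsBoundedPrimitive π σ lam) {g : Diff E M} (hg : g ∈ liftedHam E π σ) :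
    ∃ F : M → ℝ, IsPrimitive F (pullback g lam - lam) ∧ ∃ B, ∀ m, |F m| ≤ B := by
  obtain ⟨H, φ, ψ, hφ, hψ, rfl⟩ := hg
  obtain ⟨B, hB⟩ := exists_actionDensity_bound hlam hφ hπ hψ
  exact ⟨_, (hφ.lift hπ hψ).isPrimitive hlam.smooth hlam.primitive, B, abs_actionIntegral_le hB⟩

end LiftedHam

end SympHyp

end

/-! ### The cocycle and its semiboundedness -/

theorem proposition4p3
    {E : Type*} [NormedAddCommGroup E] [NormedSpace ℝ E] [FiniteDimensional ℝ E]
    {X : Type*} [TopologicalSpace X] [ChartedSpace E X] [IsManifold 𝓘(ℝ, E) ∞ X]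
    [T2Space X] [CompactSpace X] [ConnectedSpace X]
    {M : Type*} [TopologicalSpace M] [ChartedSpace E M] [IsManifold 𝓘(ℝ, E) ∞ M]
    (σ : SympHyp.DForm E X 2) (hσ : SympHyp.IsSymplectic σ)
    (π : M → X) (hπ : SympHyp.IsUniversalCover (E := E) π)
    (lam : SympHyp.DForm E M 1) (hlam : SympHyp.IsBoundedPrimitive π σ lam)
    (x : M) :
    -- every element of `Ham(X,σ)` has a lift in the group on which `𝔊` is considered
    (∀ f ∈ SympHyp.ham σ, ∃ g ∈ SympHyp.liftedHam E π σ, ∀ m : M, π (g m) = f (π m)) ∧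
    -- `𝔊_{x,lam}` is well defined: the integral can be taken along any path from `x` to `h(x)`
    (∀ g ∈ SympHyp.liftedHam E π σ, ∀ h ∈ SympHyp.liftedHam E π σ,
      (∃ γ : ℝ → M, SympHyp.IsPathFromTo (E := E) γ x (h x)) ∧
      ∀ γ : ℝ → M, SympHyp.IsPathFromTo (E := E) γ x (h x) →
        SympHyp.pathIntegral (SympHyp.pullback g lam - lam) γ = SympHyp.cocycleG x lam g h) ∧
    -- it is a two-cocycle on `Ham(X,σ)`, viewed as a group of diffeomorphisms of `M`
    SympHyp.IsTwoCocycle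
      (fun g h : SympHyp.liftedHam E π σ => SympHyp.cocycleG x lam (g : SympHyp.Diff E M) h) ∧
    -- which is semibounded
    SympHyp.IsSemibounded
      (fun g h : SympHyp.liftedHam E π σ => SympHyp.cocycleG x lam (g : SympHyp.Diff E M) h) := by
  have hπs := hπ.localDiffeo.contMDiff
  refine ⟨fun f hf => SympHyp.exists_mem_liftedHam hπ hf, fun g hg h hh => ?_, fun f g h => ?_,
    fun g => ?_⟩
  · have hp := SympHyp.exists_path_of_mem_liftedHam hh x
    obtain ⟨F, hF, -⟩ := SympHyp.exists_bounded_primitive hπs hlam hg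
    exact ⟨hp, fun γ hγ => (hF.pathIntegral_eq hγ).trans (hF.cocycleG_eq hp).symm⟩
  · have hp (k : SympHyp.liftedHam E π σ) := SympHyp.exists_path_of_mem_liftedHam k.2 x
    obtain ⟨F, hF, -⟩ := SympHyp.exists_bounded_primitive hπs hlam f.2
    obtain ⟨G, hG, -⟩ := SympHyp.exists_bounded_primitive hπs hlam g.2
    have h1 := hG.cocycleG_eq (hp h)
    have h2 := (hF.mul hG).cocycleG_eq (hp h)
    have h3 := hF.cocycleG_eq (hp (g * h))
    have h4 := hF.cocycleG_eq (hp g)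
    simp only [Subgroup.coe_mul, SympHyp.Diff.mul_apply] at h3 ⊢
    -- All four terms become differences of values of `F` and `G` at `x`, `g x`, `h x` and `g (h
    -- x)`, and these cancel.
    rw [h1, h2, h3, h4]
    ring
  · obtain ⟨F, hF, B, hB⟩ := SympHyp.exists_bounded_primitive hπs hlam g.2
    -- The value is `F (h x) - F x`, and `B` bounds `F` at every point, independently of `h`.
    refine ⟨B + B, ?_⟩
    rintro _ ⟨h, rfl⟩
    have h1 := hF.cocycleG_eq (SympHyp.exists_path_of_mem_liftedHam h.2 x)
    simp only [h1]
    exact (abs_sub _ _).trans (add_le_add (hB _) (hB _))
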